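/- Let $f:\mathbb R\to\mathbb R$ be twice differentiable with $f(u)>0$, $f'(u)\ge 0$ and $f''(u)>0$ for all $u\in\mathbb R$, and $\lim_{u\to\infty} f(u)/u=\infty$. Let $\alpha>0$ and $\lambda>0$ be fixed. Put $F(u)=\int_0^u f(t)\,dt$, let $F^{-1}:[0,\infty)\to[0,\infty)$ be the inverse of $F|_{[0,\infty)}$, and for $C\ge 0$ let $\mathcal K_C=\{(v,u): v^2/2\le C,\ u=F^{-1}(C-v^2/2)\}$. Let $v_1(C)\ge 0$ be the unique number for which $(v_1,\tfrac{\sqrt\lambda}{\alpha}v_1)\in\mathcal K_C$, that is, $F\big(\tfrac{\sqrt\lambda}{\alpha}v_1\big)+\tfrac{v_1^2}{2}=C$, and set $$L(C)=\frac{2}{\sqrt\lambda}\int_0^{v_1(C)}\frac{dv}{f\big(F^{-1}(C-\frac{v^2}{2})\big)},\qquad C\ge 0 .$$ Then: 1. For all $C>0$ and $\ell>0$, the problem $u''+\lambda f(u)=0$ in $(0,\ell)$, $u'(0)=\alpha u(0)$, $u'(\ell)=-\alpha u(\ell)$ has a solution whose trajectory $\big(\tfrac{u'(x)}{\sqrt\lambda},u(x)\big)$,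 $0\le x\le \ell$, lies on $\mathcal K_C$ if and only if $\ell=L(C)$. 2. $L$ is bounded on $[0,\infty)$. 3. $L(0)=0=\lim_{C\to 0^+}L(C)$, and $L(C)\to 0$ as $C\to\infty$. 4. $L$ is differentiable on $(0,\infty)$ and has exactly one critical point there, i.e. there is exactly one $C>0$ with $L'(C)=0$. -/

import Mathlib

open Set Filter Topology

noncomputable section

namespace RobinTimeMap

/-- The primitive `F(u) = ∫₀ᵘ f(t) dt`. -/
def primitive (f : ℝ → ℝ) (u : ℝ) : ℝ := ∫ t in (0 : ℝ)..u, f t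

/-- The inverse `F⁻¹ : [0, ∞) → [0, ∞)` of the primitive. -/
def primitiveInv (f : ℝ → ℝ) (s : ℝ) : ℝ := Function.invFunOn (primitive f) (Ici 0) s

/-- The phase plane curve `K_C` of energy level `C`, as a set of points `(v, u)`:
`u = F⁻¹(C - v² / 2)`, where `v² / 2 ≤ C`. -/
def phaseCurve (f : ℝ → ℝ) (C : ℝ) : Set (ℝ × ℝ) :=
  {p | p.1 ^ 2 / 2 ≤ C ∧ p.2 = primitiveInv f (C - p.1 ^ 2 / 2)}

/-- The line `𝓛⁺` of points `(v, u)` with `u = γ v`, `γ = √lam / α`. -/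
def robinLine (lam α : ℝ) : Set (ℝ × ℝ) := {p | p.2 = Real.sqrt lam / α * p.1}

/-- The abscissa `v₁(C) ≥ 0` of the intersection point `P⁺ = (v₁, γ v₁)` of `𝓛⁺` with `K_C`. It
exists and is unique for `C ≥ 0`, see `existsUnique_vOne`. -/
def vOne (f : ℝ → ℝ) (lam α C : ℝ) : ℝ :=
  Classical.epsilon fun v : ℝ =>
    0 ≤ v ∧ (v, Real.sqrt lam / α * v) ∈ phaseCurve f C ∩ robinLine lam α

/-- The length `L(C) = 2 ∫₀^{v₁(C)} dv / (√lam f(F⁻¹(C - v² / 2)))`. -/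
def length (f : ℝ → ℝ) (lam α C : ℝ) : ℝ :=
  2 * ∫ v in (0 : ℝ)..vOne f lam α C,
    1 / (Real.sqrt lam * f (primitiveInv f (C - v ^ 2 / 2)))

/-- `u`, with derivative `u'`, is a classical solution (of class `C¹` on `[0, ℓ]`, twice
differentiable in `(0, ℓ)`) of `u'' + lam f(u) = 0` in `(0, ℓ)` with the Robin conditions
`u'(0) = α u(0)` and `u'(ℓ) = - α u(ℓ)`. -/
structure IsRobinSolution (f : ℝ → ℝ) (lam α ℓ : ℝ) (u u' : ℝ → ℝ) : Prop where
  hasDeriv : ∀ x ∈ Icc 0 ℓ, HasDerivWithinAt u (u' x) (Icc 0 ℓ) x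
  continuousOn : ContinuousOn u' (Icc 0 ℓ)
  equation : ∀ x ∈ Ioo 0 ℓ, HasDerivAt u' (-(lam * f (u x))) x
  left : u' 0 = α * u 0
  right : u' ℓ = -(α * u ℓ)

theorem primitive_strictMono {f : ℝ → ℝ} (hc : Continuous f) (hpos : ∀ u, 0 < f u) :
    StrictMono (primitive f) := by
  refine strictMono_of_deriv_pos fun x => ?_
  have h : deriv (primitive f) x = f x := (hc.integral_hasStrictDerivAt 0 x).hasDerivAt.deriv
  rw [h]
  exact hpos x

theorem primitive_continuous {f : ℝ → ℝ} (hc : Continuous f) : Continuous (primitive f) :=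
  continuous_iff_continuousAt.2 fun x =>
    (hc.integral_hasStrictDerivAt 0 x).hasDerivAt.continuousAt

theorem primitive_zero (f : ℝ → ℝ) : primitive f 0 = 0 := by simp [primitive]

theorem le_primitive {f : ℝ → ℝ} (hc : Continuous f) (hm : Monotone f) {u : ℝ} (hu : 0 ≤ u) :
    u * f 0 ≤ primitive f u := by
  have h : ∫ _t in (0 : ℝ)..u, f 0 ≤ ∫ t in (0 : ℝ)..u, f t :=
    intervalIntegral.integral_mono_on hu (by simp) (hc.intervalIntegrable _ _)
      fun x hx => hm hx.1
  simpa [primitive] using h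

theorem exists_primitive_eq {f : ℝ → ℝ} (hc : Continuous f) (hm : Monotone f)
    (hpos : ∀ u, 0 < f u) {s : ℝ} (hs : 0 ≤ s) : ∃ u ∈ Ici (0 : ℝ), primitive f u = s := by
  have hs' : 0 ≤ s / f 0 := div_nonneg hs (hpos 0).le
  have h1 : s ≤ primitive f (s / f 0) := by
    have := le_primitive hc hm hs'
    rwa [div_mul_cancel₀ _ (hpos 0).ne'] at this
  obtain ⟨u, hu, h⟩ := intermediate_value_Icc hs' (primitive_continuous hc).continuousOn
    (show s ∈ Icc _ _ from ⟨by rw [primitive_zero]; exact hs, h1⟩)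
  exact ⟨u, hu.1, h⟩

theorem primitiveInv_eq_iff {f : ℝ → ℝ} (hc : Continuous f) (hm : Monotone f)
    (hpos : ∀ u, 0 < f u) {s u : ℝ} (hs : 0 ≤ s) : u = primitiveInv f s ↔ primitive f u = s := by
  have h : primitive f (primitiveInv f s) = s :=
    Function.invFunOn_eq (exists_primitive_eq hc hm hpos hs)
  constructor
  · rintro rfl
    exact h
  · intro hu
    exact (primitive_strictMono hc hpos).injective (hu.trans h.symm)

theorem existsUnique_vOne {f : ℝ → ℝ} (hc : Continuous f) (hm : Monotone f)
    (hpos : ∀ u, 0 < f u) {lam α C : ℝ} (hlam : 0 < lam) (hα : 0 < α) (hC : 0 ≤ C) :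
    ∃! v : ℝ, 0 ≤ v ∧ (v, Real.sqrt lam / α * v) ∈ phaseCurve f C ∩ robinLine lam α := by
  have hγ : 0 < Real.sqrt lam / α := div_pos (Real.sqrt_pos.2 hlam) hα
  set γ := Real.sqrt lam / α with hγd
  have hF := primitive_strictMono hc hpos
  have hnn : ∀ v : ℝ, 0 ≤ v → 0 ≤ primitive f (γ * v) := fun v hv => by
    rw [← primitive_zero f]
    exact hF.monotone (mul_nonneg hγ.le hv)
  have key : ∀ v : ℝ, 0 ≤ v → ((v, γ * v) ∈ phaseCurve f C ∩ robinLine lam α ↔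
      primitive f (γ * v) + v ^ 2 / 2 = C) := by
    intro v hv
    constructor
    · rintro ⟨⟨h1, h2⟩, -⟩
      simp only at h1 h2
      have := (primitiveInv_eq_iff hc hm hpos (sub_nonneg.2 h1)).1 h2
      linarith
    · intro h
      have h1 : v ^ 2 / 2 ≤ C := by linarith [hnn v hv]
      exact ⟨⟨h1, (primitiveInv_eq_iff hc hm hpos (sub_nonneg.2 h1)).2 (by simp only; linarith)⟩,
        rfl⟩
  have hcont : Continuous fun v : ℝ => primitive f (γ * v) + v ^ 2 / 2 :=
    ((primitive_continuous hc).comp (continuous_const.mul continuous_id)).add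
      ((continuous_id.pow 2).div_const 2)
  have hup : C ≤ primitive f (γ * (C + 1)) + (C + 1) ^ 2 / 2 := by
    nlinarith [hnn (C + 1) (by linarith)]
  obtain ⟨v, hv, hvC⟩ := intermediate_value_Icc (show (0 : ℝ) ≤ C + 1 by linarith)
    hcont.continuousOn (show C ∈ Icc _ _ from ⟨by simpa [primitive_zero] using hC, hup⟩)
  refine ⟨v, ⟨hv.1, (key v hv.1).2 hvC⟩, ?_⟩
  rintro w ⟨hw, hwC⟩
  have hwC' := (key w hw).1 hwC
  simp only at hvC
  rcases lt_trichotomy w v with h | h | h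
  · have := hF (mul_lt_mul_of_pos_left h hγ)
    nlinarith [hv.1]
  · exact h
  · have := hF (mul_lt_mul_of_pos_left h hγ)
    nlinarith [hv.1]

end RobinTimeMap

end

/-!
After rescaling `x` by `√lam`, the solutions are the trajectories of `u' = -v`, `v' = f(u)`, whose
energy `F(u) + v² / 2` is conserved, and `L(C)` is `2 / √lam` times the time `T` that the
trajectory of energy `C` takes from its apex `v = 0` to the Robin line `u = γ v`, `γ = √lam / α`.

`T` vanishes at `C = 0`, and tends to `0` as `C → ∞` because `f` is superlinear, so it has a
critical point by Rolle's theorem. For uniqueness, let `(r, φ)` be the derivative of the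
trajectory with respect to its energy. Up to a positive factor, the derivative of `T` is `φ - γ r`
at the Robin line, so at a critical point `(r, φ)` satisfies the Robin condition `φ = γ r` there,
which forces `φ > 0` all along the trajectory. As `f` lies strictly above its tangents, the
Wronskian of `(r, φ)` with the difference to any other trajectory then strictly decreases from the
value `0` at the apex, and its sign at the final time says that the other trajectory has already
crossed the Robin line. Hence every critical point of `T` is a strict global maximum, so there is
only one.
-/

noncomputable section

namespace RobinTimeMap

variable {f : ℝ → ℝ}

section Calculus

theorem continuous_deriv_of_strictConvexOn (hf : Differentiable ℝ f)
    (hconv : StrictConvexOn ℝ univ f) : Continuous (deriv f) := by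
  have hmono : StrictMono (deriv f) :=
    strictMonoOn_univ.1 (hconv.strictMonoOn_deriv fun x _ => hf x)
  have : OrdConnected (range (deriv f)) := by
    simpa only [image_univ] using ordConnected_univ.image_deriv fun x _ => hf x
  exact (hmono.isEmbedding_of_ordConnected this).continuous

theorem tangent_lt_of_strictConvexOn (hf : Differentiable ℝ f) (hconv : StrictConvexOn ℝ univ f)
    {a b : ℝ} (hab : a ≠ b) : f a + deriv f a * (b - a) < f b := by
  rcases hab.lt_or_gt with h | h
  · have := hconv.deriv_lt_slope (mem_univ a) (mem_univ b) h (hf a)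
    rw [slope_def_field, lt_div_iff₀ (sub_pos.2 h)] at this
    linarith
  · have := hconv.slope_lt_deriv (mem_univ b) (mem_univ a) h (hf a)
    rw [slope_def_field, div_lt_iff₀ (sub_pos.2 h)] at this
    linarith

theorem hasDerivAt_comp₂_of_continuousAt_partials {g g₁ g₂ : ℝ → ℝ → ℝ} {a b : ℝ → ℝ}
    {a' b' x : ℝ} (hg₁ : ∀ᶠ p in 𝓝 (a x, b x), HasDerivAt (g · p.2) (g₁ p.1 p.2) p.1)
    (hg₂ : ∀ᶠ p in 𝓝 (a x, b x), HasDerivAt (g p.1) (g₂ p.1 p.2) p.2)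
    (hc₁ : ContinuousAt (Function.uncurry g₁) (a x, b x))
    (hc₂ : ContinuousAt (Function.uncurry g₂) (a x, b x))
    (ha : HasDerivAt a a' x) (hb : HasDerivAt b b' x) :
    HasDerivAt (fun y => g (a y) (b y)) (g₁ (a x) (b x) * a' + g₂ (a x) (b x) * b') x := by
  have hspan : Continuous fun c : ℝ => ContinuousLinearMap.toSpanSingleton ℝ c :=
    (ContinuousLinearMap.toSpanSingletonCLE (𝕜 := ℝ) (E := ℝ)).continuous
  have hg := hasStrictFDerivAt_uncurry_coprod (f := g)
    (f₁ := fun y z => ContinuousLinearMap.toSpanSingleton ℝ (g₁ y z))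
    (f₂ := fun y z => ContinuousLinearMap.toSpanSingleton ℝ (g₂ y z))
    (hg₁.mono fun _ h => h.hasFDerivAt) (hg₂.mono fun _ h => h.hasFDerivAt)
    (hspan.continuousAt.comp hc₁) (hspan.continuousAt.comp hc₂)
  refine (hg.hasFDerivAt.comp_hasDerivAt x (ha.prodMk hb)).congr_deriv ?_
  simp [Function.HasUncurry.uncurry, mul_comm]

theorem lt_of_hasDerivAt_nonpos_of_neg_left {g g' : ℝ → ℝ} {a b : ℝ} (hab : a < b)
    (hg : ∀ t ∈ Icc a b, HasDerivAt g (g' t) t) (hg' : ∀ t ∈ Icc a b, g' t ≤ 0)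
    (ha : g' a < 0) : g b < g a := by
  have hanti : AntitoneOn g (Icc a b) :=
    antitoneOn_of_hasDerivWithinAt_nonpos (convex_Icc a b)
      (fun t ht => (hg t ht).continuousAt.continuousWithinAt)
      (fun t ht => (hg t (interior_subset ht)).hasDerivWithinAt)
      fun t ht => hg' t (interior_subset ht)
  have hal : a ∈ Icc a b := left_mem_Icc.2 hab.le
  have hbr : b ∈ Icc a b := right_mem_Icc.2 hab.le
  by_contra! hle
  have hconst : ∀ t ∈ Icc a b, g t = g a := fun t ht =>
    le_antisymm (hanti hal ht ht.1) (hle.trans (hanti ht hbr ht.2))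
  exact ha.ne ((uniqueDiffOn_Icc hab a hal).eq_deriv _ (hg a hal).hasDerivWithinAt
    ((hasDerivWithinAt_const a _ (g a)).congr hconst rfl))

end Calculus

section Comparison

/-- `(v, u)` solves the phase plane system `u' = -v`, `v' = f(u)` on `s`. The equation
`u'' + lam f(u) = 0` takes this form after rescaling `x` by `√lam`, with `v = -u'`. -/
structure IsTrajectory (f : ℝ → ℝ) (s : Set ℝ) (v u : ℝ → ℝ) : Prop where
  position : ∀ t ∈ s, HasDerivAt u (-v t) t
  velocity : ∀ t ∈ s, HasDerivAt v (f (u t)) t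

/-- `(r, φ)` solves on `s` the linearization `φ' = -r`, `r' = f'(u) φ` of the phase plane system
along `u`. -/
structure IsLinearizedTrajectory (f : ℝ → ℝ) (s : Set ℝ) (u r φ : ℝ → ℝ) : Prop where
  position : ∀ t ∈ s, HasDerivAt φ (-r t) t
  velocity : ∀ t ∈ s, HasDerivAt r (deriv f (u t) * φ t) t

/-- The Wronskian of the difference `(v - v₀, u - u₀)` of two trajectories and of a solution
`(r, φ)` of the linearization along `u₀`. -/
def wronskian (v₀ u₀ v u r φ : ℝ → ℝ) (t : ℝ) : ℝ :=
  (v₀ t - v t) * φ t + (u t - u₀ t) * r t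

variable {s : Set ℝ} {v₀ u₀ v u r φ : ℝ → ℝ}

theorem wronskian_hasDerivAt (h₀ : IsTrajectory f s v₀ u₀) (h : IsTrajectory f s v u)
    (hφ : IsLinearizedTrajectory f s u₀ r φ) {t : ℝ} (ht : t ∈ s) :
    HasDerivAt (wronskian v₀ u₀ v u r φ)
      (-(φ t * (f (u t) - (f (u₀ t) + deriv f (u₀ t) * (u t - u₀ t))))) t := by
  refine ((((h₀.velocity t ht).sub (h.velocity t ht)).mul (hφ.position t ht)).add
    (((h.position t ht).sub (h₀.position t ht)).mul (hφ.velocity t ht))).congr_deriv ?_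
  simp only [Pi.sub_apply]
  ring

theorem wronskian_lt_of_strictConvexOn (hf : Differentiable ℝ f)
    (hconv : StrictConvexOn ℝ univ f) {a b : ℝ} (hab : a < b)
    (h₀ : IsTrajectory f (Icc a b) v₀ u₀) (h : IsTrajectory f (Icc a b) v u)
    (hφ : IsLinearizedTrajectory f (Icc a b) u₀ r φ) (hφpos : ∀ t ∈ Icc a b, 0 < φ t)
    (hne : u₀ a ≠ u a) :
    wronskian v₀ u₀ v u r φ b < wronskian v₀ u₀ v u r φ a := by
  have hgap : ∀ {t}, u₀ t ≠ u t → 0 < f (u t) - (f (u₀ t) + deriv f (u₀ t) * (u t - u₀ t)) :=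
    fun hne => sub_pos.2 (tangent_lt_of_strictConvexOn hf hconv hne)
  have ha : a ∈ Icc a b := left_mem_Icc.2 hab.le
  refine lt_of_hasDerivAt_nonpos_of_neg_left hab (fun t ht => wronskian_hasDerivAt h₀ h hφ ht)
    (fun t ht => ?_) (neg_neg_of_pos (mul_pos (hφpos a ha) (hgap hne)))
  rcases eq_or_ne (u₀ t) (u t) with heq | hne
  · simp [heq]
  · exact neg_nonpos.2 (mul_pos (hφpos t ht) (hgap hne)).le

end Comparison

section Inverse

theorem primitive_hasStrictDerivAt (hc : Continuous f) (u : ℝ) :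
    HasStrictDerivAt (primitive f) (f u) u :=
  hc.integral_hasStrictDerivAt 0 u

theorem primitive_nonneg (hc : Continuous f) (hpos : ∀ u, 0 < f u) {u : ℝ} (hu : 0 ≤ u) :
    0 ≤ primitive f u := by
  rw [← primitive_zero f]
  exact (primitive_strictMono hc hpos).monotone hu

/-- The extension of `primitiveInv f` to the real line by its value at `0`, so that no junk values
of `primitiveInv f` enter the integrals below. -/
def primitiveInvExt (f : ℝ → ℝ) (s : ℝ) : ℝ := primitiveInv f (max s 0)

theorem primitiveInvExt_of_nonneg {s : ℝ} (hs : 0 ≤ s) :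
    primitiveInvExt f s = primitiveInv f s := by
  rw [primitiveInvExt, max_eq_left hs]

/-- The standing assumptions on the nonlinearity `f` that make its primitive a continuous
increasing bijection of `[0, ∞)`. -/
structure IsSource (f : ℝ → ℝ) : Prop where
  continuous : Continuous f
  monotone : Monotone f
  pos : ∀ u, 0 < f u

namespace IsSource

theorem primitive_primitiveInvExt (hf : IsSource f) (s : ℝ) :
    primitive f (primitiveInvExt f s) = max s 0 :=
  (primitiveInv_eq_iff hf.continuous hf.monotone hf.pos (le_max_right s 0)).1 rfl

theorem primitiveInvExt_nonneg (hf : IsSource f) (s : ℝ) : 0 ≤ primitiveInvExt f s :=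
  Function.invFunOn_mem
    (exists_primitive_eq hf.continuous hf.monotone hf.pos (le_max_right s 0))

theorem primitiveInvExt_primitive (hf : IsSource f) {u : ℝ} (hu : 0 ≤ u) :
    primitiveInvExt f (primitive f u) = u := by
  refine (primitive_strictMono hf.continuous hf.pos).injective ?_
  rw [hf.primitive_primitiveInvExt, max_eq_left (primitive_nonneg hf.continuous hf.pos hu)]

theorem primitiveInvExt_monotone (hf : IsSource f) : Monotone (primitiveInvExt f) := by
  intro a b hab
  rw [← (primitive_strictMono hf.continuous hf.pos).le_iff_le, hf.primitive_primitiveInvExt,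
    hf.primitive_primitiveInvExt]
  exact max_le_max_right _ hab

theorem primitiveInvExt_continuous (hf : IsSource f) : Continuous (primitiveInvExt f) := by
  have hmono : Monotone (codRestrict (primitiveInvExt f) (Ici 0) hf.primitiveInvExt_nonneg) :=
    fun _ _ h => hf.primitiveInvExt_monotone h
  have hsurj : Function.Surjective
      (codRestrict (primitiveInvExt f) (Ici 0) hf.primitiveInvExt_nonneg) :=
    fun u => ⟨primitive f u, Subtype.ext (hf.primitiveInvExt_primitive u.2)⟩
  exact continuous_subtype_val.comp (hmono.continuous_of_surjective hsurj)

theorem primitiveInvExt_hasDerivAt (hf : IsSource f) {s : ℝ} (hs : 0 < s) :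
    HasDerivAt (primitiveInvExt f) (f (primitiveInvExt f s))⁻¹ s := by
  refine HasDerivAt.of_local_left_inverse (f := primitive f)
    hf.primitiveInvExt_continuous.continuousAt
    (primitive_hasStrictDerivAt hf.continuous _).hasDerivAt (hf.pos _).ne' ?_
  filter_upwards [lt_mem_nhds hs] with y hy
  rw [hf.primitive_primitiveInvExt, max_eq_left hy.le]

end IsSource

end Inverse

section TravelTime

/-- The slowness `dt / dv = 1 / f(u)` of a trajectory of `u' = -v`, `v' = f(u)` at a point with
`F(u) = s`. -/
def slowness (f : ℝ → ℝ) (s : ℝ) : ℝ := (f (primitiveInvExt f s))⁻¹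

/-- The derivative of the slowness on `(0, ∞)`. -/
def slownessDeriv (f : ℝ → ℝ) (s : ℝ) : ℝ :=
  -deriv f (primitiveInvExt f s) / f (primitiveInvExt f s) ^ 3

/-- The time the trajectory of `u' = -v`, `v' = f(u)` of energy `C` takes from its apex, where
`v = 0`, to the point of abscissa `v`. -/
def travelTime (f : ℝ → ℝ) (C v : ℝ) : ℝ := ∫ s in (0 : ℝ)..v, slowness f (C - s ^ 2 / 2)

/-- The derivative of the travel time with respect to the energy. -/
def travelTimeDeriv (f : ℝ → ℝ) (C v : ℝ) : ℝ :=
  ∫ s in (0 : ℝ)..v, slownessDeriv f (C - s ^ 2 / 2)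

theorem travelTime_zero (C : ℝ) : travelTime f C 0 = 0 := intervalIntegral.integral_same

theorem travelTimeDeriv_zero (C : ℝ) : travelTimeDeriv f C 0 = 0 := intervalIntegral.integral_same

theorem travelTime_neg (C v : ℝ) : travelTime f C (-v) = -travelTime f C v := by
  have := intervalIntegral.integral_comp_neg (a := 0) (b := v)
    fun s => slowness f (C - s ^ 2 / 2)
  simp only [even_two, Even.neg_pow, neg_zero] at this
  rw [travelTime, travelTime, this, intervalIntegral.integral_symm]

namespace IsSource

theorem slowness_pos (hf : IsSource f) (s : ℝ) : 0 < slowness f s := inv_pos.2 (hf.pos _)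

theorem slowness_continuous (hf : IsSource f) : Continuous (slowness f) :=
  (hf.continuous.comp hf.primitiveInvExt_continuous).inv₀ fun _ => (hf.pos _).ne'

theorem slowness_antitone (hf : IsSource f) : Antitone (slowness f) := fun _ _ h =>
  inv_anti₀ (hf.pos _) (hf.monotone (hf.primitiveInvExt_monotone h))

theorem slownessDeriv_continuous (hf : IsSource f) (hf' : Continuous (deriv f)) :
    Continuous (slownessDeriv f) :=
  (hf'.comp hf.primitiveInvExt_continuous).neg.div
    ((hf.continuous.comp hf.primitiveInvExt_continuous).pow 3) fun _ => (pow_pos (hf.pos _) 3).ne'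

theorem slownessDeriv_nonpos (hf : IsSource f) (s : ℝ) : slownessDeriv f s ≤ 0 :=
  div_nonpos_of_nonpos_of_nonneg (neg_nonpos.2 hf.monotone.deriv_nonneg)
    (pow_pos (hf.pos _) 3).le

theorem slowness_hasDerivAt (hf : IsSource f) (hd : Differentiable ℝ f) {s : ℝ} (hs : 0 < s) :
    HasDerivAt (slowness f) (slownessDeriv f s) s := by
  have hne := (hf.pos (primitiveInvExt f s)).ne'
  refine (((hd _).hasDerivAt.comp s (hf.primitiveInvExt_hasDerivAt hs)).inv hne).congr_deriv ?_
  rw [slownessDeriv, Function.comp_apply]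
  field_simp

theorem travelTime_continuous_uncurry (hf : IsSource f) :
    Continuous (Function.uncurry (travelTime f)) := by
  have h := hf.slowness_continuous
  exact intervalIntegral.continuous_parametric_intervalIntegral_of_continuous
    (f := fun (p : ℝ × ℝ) s => slowness f (p.1 - s ^ 2 / 2)) (by fun_prop) continuous_snd

theorem travelTimeDeriv_continuous_uncurry (hf : IsSource f) (hf' : Continuous (deriv f)) :
    Continuous (Function.uncurry (travelTimeDeriv f)) := by
  have h := hf.slownessDeriv_continuous hf'
  exact intervalIntegral.continuous_parametric_intervalIntegral_of_continuous
    (f := fun (p : ℝ × ℝ) s => slownessDeriv f (p.1 - s ^ 2 / 2)) (by fun_prop) continuous_snd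

theorem travelTime_hasStrictDerivAt (hf : IsSource f) (C v : ℝ) :
    HasStrictDerivAt (travelTime f C) (slowness f (C - v ^ 2 / 2)) v := by
  have h := hf.slowness_continuous
  exact Continuous.integral_hasStrictDerivAt (f := fun s => slowness f (C - s ^ 2 / 2))
    (by fun_prop) 0 v

theorem travelTimeDeriv_hasDerivAt (hf : IsSource f) (hf' : Continuous (deriv f)) (C v : ℝ) :
    HasDerivAt (travelTimeDeriv f C) (slownessDeriv f (C - v ^ 2 / 2)) v := by
  have h := hf.slownessDeriv_continuous hf'
  exact (Continuous.integral_hasStrictDerivAt (f := fun s => slownessDeriv f (C - s ^ 2 / 2))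
    (by fun_prop) 0 v).hasDerivAt

theorem travelTime_hasDerivAt_energy (hf : IsSource f) (hd : Differentiable ℝ f)
    (hf' : Continuous (deriv f)) {C v : ℝ} (hv : v ^ 2 / 2 < C) :
    HasDerivAt (fun c => travelTime f c v) (travelTimeDeriv f C v) C := by
  have hc := hf.slowness_continuous
  have hc' := hf.slownessDeriv_continuous hf'
  obtain ⟨M, hM⟩ := (isCompact_Icc (a := 0) (b := C + 1)).exists_bound_of_continuousOn
    hc'.continuousOn
  have hsq : ∀ s ∈ uIoc 0 v, s ^ 2 ≤ v ^ 2 := fun s hs => by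
    have := abs_sub_left_of_mem_uIcc (uIoc_subset_uIcc hs)
    rw [sub_zero, sub_zero] at this
    exact sq_le_sq.2 this
  refine (intervalIntegral.hasDerivAt_integral_of_dominated_loc_of_deriv_le
    (F := fun c s => slowness f (c - s ^ 2 / 2))
    (F' := fun c s => slownessDeriv f (c - s ^ 2 / 2)) (bound := fun _ => M)
    (Ioo_mem_nhds hv (lt_add_one C)) (Eventually.of_forall fun c => ?_) ?_ ?_ ?_ ?_ ?_).2
  · exact Continuous.aestronglyMeasurable (by fun_prop)
  · exact Continuous.intervalIntegrable (by fun_prop) _ _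
  · exact Continuous.aestronglyMeasurable (by fun_prop)
  · refine .of_forall fun s hs c hc => hM _ ⟨?_, ?_⟩
    · linarith [hsq s hs, hc.1]
    · linarith [sq_nonneg s, hc.2]
  · exact intervalIntegrable_const
  · refine .of_forall fun s hs c hc => ?_
    have : 0 < c - s ^ 2 / 2 := by linarith [hsq s hs, hc.1]
    exact (hf.slowness_hasDerivAt hd this).comp_sub_const c (s ^ 2 / 2)

theorem travelTimeDeriv_nonpos (hf : IsSource f) (C : ℝ) {v : ℝ} (hv : 0 ≤ v) :
    travelTimeDeriv f C v ≤ 0 := by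
  have := intervalIntegral.integral_nonneg (μ := MeasureTheory.volume) hv
    (f := fun s => -slownessDeriv f (C - s ^ 2 / 2)) fun s _ =>
      neg_nonneg.2 (hf.slownessDeriv_nonpos _)
  rw [intervalIntegral.integral_neg] at this
  exact neg_nonneg.1 this

theorem travelTime_strictMono (hf : IsSource f) (C : ℝ) : StrictMono (travelTime f C) :=
  strictMono_of_hasDerivAt_pos (fun v => (hf.travelTime_hasStrictDerivAt C v).hasDerivAt)
    fun _ => hf.slowness_pos _

theorem mul_slowness_le_travelTime (hf : IsSource f) (C : ℝ) {v : ℝ} (hv : 0 ≤ v) :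
    v * slowness f C ≤ travelTime f C v := by
  have hc := hf.slowness_continuous
  have := intervalIntegral.integral_mono_on (μ := MeasureTheory.volume) hv
    (f := fun _ => slowness f C) (g := fun s => slowness f (C - s ^ 2 / 2)) (by simp)
    (Continuous.intervalIntegrable (by fun_prop) 0 v) fun s _ =>
      hf.slowness_antitone (by linarith [sq_nonneg s])
  rwa [intervalIntegral.integral_const, smul_eq_mul, sub_zero] at this

theorem travelTime_le_mul_slowness (hf : IsSource f) (C : ℝ) {v : ℝ} (hv : 0 ≤ v) :
    travelTime f C v ≤ v * slowness f (C - v ^ 2 / 2) := by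
  have hc := hf.slowness_continuous
  have := intervalIntegral.integral_mono_on (μ := MeasureTheory.volume) hv
    (f := fun s => slowness f (C - s ^ 2 / 2)) (g := fun _ => slowness f (C - v ^ 2 / 2))
    (Continuous.intervalIntegrable (by fun_prop) 0 v) (by simp) fun s hs =>
      hf.slowness_antitone (by linarith [pow_le_pow_left₀ hs.1 hs.2 2])
  rwa [intervalIntegral.integral_const, smul_eq_mul, sub_zero] at this

theorem travelTime_surjective (hf : IsSource f) (C : ℝ) :
    Function.Surjective (travelTime f C) := by
  have hcont : Continuous (travelTime f C) :=
    hf.travelTime_continuous_uncurry.comp (Continuous.prodMk_right C)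
  have htop : Tendsto (travelTime f C) atTop atTop := by
    refine tendsto_atTop_mono' atTop ?_ (tendsto_id.atTop_mul_const (hf.slowness_pos C))
    filter_upwards [eventually_ge_atTop 0] with v hv
    exact hf.mul_slowness_le_travelTime C hv
  have hbot : Tendsto (travelTime f C) atBot atBot :=
    (tendsto_neg_atTop_atBot.comp (htop.comp tendsto_neg_atBot_atTop)).congr fun v => by
      simp only [Function.comp_apply, travelTime_neg, neg_neg]
  exact hcont.surjective htop hbot

end IsSource

end TravelTime

section Trajectories

/-- The abscissa, at time `t`, of the trajectory of energy `C` that is at its apex at time `0`. -/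
def velocity (f : ℝ → ℝ) (C : ℝ) : ℝ → ℝ := Function.invFun (travelTime f C)

/-- The ordinate, at time `t`, of the trajectory of energy `C` that is at its apex at time `0`. -/
def position (f : ℝ → ℝ) (C t : ℝ) : ℝ := primitiveInvExt f (C - velocity f C t ^ 2 / 2)

/-- The derivative of `velocity f C t` with respect to the energy `C`. -/
def velocityVariation (f : ℝ → ℝ) (C t : ℝ) : ℝ :=
  -(f (position f C t) * travelTimeDeriv f C (velocity f C t))

/-- The derivative of `position f C t` with respect to the energy `C`. -/
def positionVariation (f : ℝ → ℝ) (C t : ℝ) : ℝ :=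
  (f (position f C t))⁻¹ + velocity f C t * travelTimeDeriv f C (velocity f C t)

namespace IsSource

theorem travelTime_velocity (hf : IsSource f) (C t : ℝ) : travelTime f C (velocity f C t) = t :=
  Function.rightInverse_invFun (hf.travelTime_surjective C) t

theorem velocity_travelTime (hf : IsSource f) (C v : ℝ) : velocity f C (travelTime f C v) = v :=
  Function.leftInverse_invFun (hf.travelTime_strictMono C).injective v

theorem velocity_zero (hf : IsSource f) (C : ℝ) : velocity f C 0 = 0 := by
  simpa only [travelTime_zero] using hf.velocity_travelTime C 0

theorem velocity_neg (hf : IsSource f) (C t : ℝ) : velocity f C (-t) = -velocity f C t := by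
  conv_lhs => rw [← hf.travelTime_velocity C t, ← travelTime_neg, hf.velocity_travelTime]

theorem position_neg (hf : IsSource f) (C t : ℝ) : position f C (-t) = position f C t := by
  rw [position, position, hf.velocity_neg, neg_sq]

theorem velocity_monotone (hf : IsSource f) (C : ℝ) : Monotone (velocity f C) := fun a b hab => by
  rwa [← (hf.travelTime_strictMono C).le_iff_le, hf.travelTime_velocity, hf.travelTime_velocity]

theorem velocity_nonneg (hf : IsSource f) (C : ℝ) {t : ℝ} (ht : 0 ≤ t) : 0 ≤ velocity f C t :=
  hf.velocity_zero C ▸ hf.velocity_monotone C ht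

theorem abs_velocity_le (hf : IsSource f) {C v t : ℝ} (ht : |t| ≤ travelTime f C v) :
    |velocity f C t| ≤ v := by
  obtain ⟨h1, h2⟩ := abs_le.1 ht
  rw [← travelTime_neg] at h1
  exact abs_le.2 ⟨hf.velocity_travelTime C (-v) ▸ hf.velocity_monotone C h1,
    hf.velocity_travelTime C v ▸ hf.velocity_monotone C h2⟩

theorem velocity_hasDerivAt (hf : IsSource f) (C t : ℝ) :
    HasDerivAt (velocity f C) (f (position f C t)) t := by
  have h := (hf.travelTime_hasStrictDerivAt C (velocity f C t)).to_local_left_inverse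
    (hf.slowness_pos _).ne' (Eventually.of_forall (hf.velocity_travelTime C))
  rw [hf.travelTime_velocity] at h
  exact h.hasDerivAt.congr_deriv (inv_inv _)

theorem isTrajectory (hf : IsSource f) (C : ℝ) :
    IsTrajectory f {t | velocity f C t ^ 2 / 2 < C} (velocity f C) (position f C) where
  velocity t _ := hf.velocity_hasDerivAt C t
  position t ht := by
    have hkin := (((hf.velocity_hasDerivAt C t).pow 2).div_const 2).const_sub C
    refine ((hf.primitiveInvExt_hasDerivAt (sub_pos.2 ht)).comp t hkin).congr_deriv ?_
    have hne := (hf.pos (position f C t)).ne'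
    change (f (position f C t))⁻¹ * _ = _
    push_cast
    field_simp

theorem isLinearizedTrajectory (hf : IsSource f) (hd : Differentiable ℝ f)
    (hf' : Continuous (deriv f)) (C : ℝ) :
    IsLinearizedTrajectory f {t | velocity f C t ^ 2 / 2 < C} (position f C)
      (velocityVariation f C) (positionVariation f C) := by
  have hV := fun t => hf.velocity_hasDerivAt C t
  have hτ : ∀ t, HasDerivAt (fun t => travelTimeDeriv f C (velocity f C t))
      (-deriv f (position f C t) / f (position f C t) ^ 3 * f (position f C t)) t := fun t =>
    (hf.travelTimeDeriv_hasDerivAt hf' C _).comp t (hV t)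
  have hfP : ∀ t, velocity f C t ^ 2 / 2 < C → HasDerivAt (fun t => f (position f C t))
      (deriv f (position f C t) * -velocity f C t) t := fun t ht =>
    (hd _).hasDerivAt.comp t ((hf.isTrajectory C).position t ht)
  constructor
  all_goals
    intro t ht
    have hne := (hf.pos (position f C t)).ne'
  · refine (((hfP t ht).inv hne).add ((hV t).mul (hτ t))).congr_deriv ?_
    simp only [velocityVariation]
    field_simp
    ring
  · refine ((hfP t ht).mul (hτ t)).neg.congr_deriv ?_
    simp only [positionVariation]
    field_simp
    ring

end IsSource

end Trajectories

section HalfTime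

/-- The energy of the trajectory through the point `(w, γ w)` of the Robin line. -/
def robinEnergy (f : ℝ → ℝ) (γ w : ℝ) : ℝ := primitive f (γ * w) + w ^ 2 / 2

/-- The time the trajectory through the point `(w, γ w)` of the Robin line takes to get there from
its apex. The trajectories are parametrized by `w = v₁(C)` instead of `C`, so that
`L(C) = 2 / √lam * halfTime f γ (v₁(C))` with `γ = √lam / α`. -/
def halfTime (f : ℝ → ℝ) (γ w : ℝ) : ℝ := travelTime f (robinEnergy f γ w) w

variable {γ w : ℝ}

theorem robinEnergy_zero (γ : ℝ) : robinEnergy f γ 0 = 0 := by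
  simp [robinEnergy, primitive_zero]

theorem halfTime_zero (γ : ℝ) : halfTime f γ 0 = 0 := travelTime_zero _

theorem robinEnergy_hasStrictDerivAt (hc : Continuous f) (γ w : ℝ) :
    HasStrictDerivAt (robinEnergy f γ) (γ * f (γ * w) + w) w := by
  have hline : HasStrictDerivAt (fun w : ℝ => γ * w) γ w := by
    simpa using (hasStrictDerivAt_id w).const_mul γ
  have hsq : HasStrictDerivAt (fun w : ℝ => w ^ 2 / 2) w w := by
    simpa using ((hasStrictDerivAt_id w).pow 2).div_const 2
  exact (((primitive_hasStrictDerivAt hc (γ * w)).comp w hline).add hsq).congr_deriv (by ring)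

theorem robinEnergy_strictMonoOn (hc : Continuous f) (hpos : ∀ u, 0 < f u) (hγ : 0 ≤ γ) :
    StrictMonoOn (robinEnergy f γ) (Ici 0) := by
  intro a ha b _ hab
  have hF := (primitive_strictMono hc hpos).monotone (mul_le_mul_of_nonneg_left hab.le hγ)
  have hsq := pow_lt_pow_left₀ hab ha two_ne_zero
  simp only [robinEnergy]
  linarith

theorem robinEnergy_nonneg (hc : Continuous f) (hpos : ∀ u, 0 < f u) (hγ : 0 ≤ γ) (hw : 0 ≤ w) :
    0 ≤ robinEnergy f γ w :=
  add_nonneg (primitive_nonneg hc hpos (mul_nonneg hγ hw)) (by positivity)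

theorem sq_lt_robinEnergy (hc : Continuous f) (hpos : ∀ u, 0 < f u) (hγ : 0 < γ) (hw : 0 < w) :
    w ^ 2 / 2 < robinEnergy f γ w := by
  have := primitive_strictMono hc hpos (mul_pos hγ hw)
  rw [primitive_zero] at this
  exact lt_add_of_pos_left _ this

namespace IsSource

theorem primitiveInvExt_robinEnergy_sub (hf : IsSource f) (hγ : 0 ≤ γ) (hw : 0 ≤ w) :
    primitiveInvExt f (robinEnergy f γ w - w ^ 2 / 2) = γ * w := by
  rw [robinEnergy, add_sub_cancel_right, hf.primitiveInvExt_primitive (mul_nonneg hγ hw)]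

theorem halfTime_continuous (hf : IsSource f) (γ : ℝ) : Continuous (halfTime f γ) := by
  have hE : Continuous (robinEnergy f γ) := continuous_iff_continuousAt.2 fun w =>
    (robinEnergy_hasStrictDerivAt hf.continuous γ w).hasDerivAt.continuousAt
  exact hf.travelTime_continuous_uncurry.comp (hE.prodMk continuous_id)

theorem halfTime_nonneg (hf : IsSource f) (γ : ℝ) (hw : 0 ≤ w) : 0 ≤ halfTime f γ w :=
  (travelTime_zero _).symm.trans_le ((hf.travelTime_strictMono _).monotone hw)

theorem halfTime_pos (hf : IsSource f) (γ : ℝ) (hw : 0 < w) : 0 < halfTime f γ w :=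
  (travelTime_zero _).symm.trans_lt (hf.travelTime_strictMono _ hw)

theorem halfTime_le (hf : IsSource f) (hγ : 0 ≤ γ) (hw : 0 ≤ w) :
    halfTime f γ w ≤ w * (f (γ * w))⁻¹ := by
  rw [← hf.primitiveInvExt_robinEnergy_sub hγ hw]
  exact hf.travelTime_le_mul_slowness _ hw

theorem tendsto_halfTime_atTop (hf : IsSource f) (hsuper : Tendsto (fun u => f u / u) atTop atTop)
    (hγ : 0 < γ) : Tendsto (halfTime f γ) atTop (𝓝 0) := by
  have hbound : Tendsto (fun w => w * (f (γ * w))⁻¹) atTop (𝓝 0) := by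
    have := ((tendsto_inv_atTop_zero.comp hsuper).comp
      (tendsto_id.const_mul_atTop hγ)).const_mul γ⁻¹
    rw [mul_zero] at this
    refine this.congr fun w => ?_
    simp only [Function.comp_apply, id_eq, inv_div]
    field_simp
  refine squeeze_zero' ?_ ?_ hbound
  · filter_upwards [eventually_ge_atTop 0] with w hw
    exact hf.halfTime_nonneg γ hw
  · filter_upwards [eventually_ge_atTop 0] with w hw
    exact hf.halfTime_le hγ.le hw

theorem velocity_halfTime (hf : IsSource f) (γ w : ℝ) :
    velocity f (robinEnergy f γ w) (halfTime f γ w) = w :=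
  hf.velocity_travelTime _ w

theorem position_halfTime (hf : IsSource f) (hγ : 0 ≤ γ) (hw : 0 ≤ w) :
    position f (robinEnergy f γ w) (halfTime f γ w) = γ * w := by
  rw [position, hf.velocity_halfTime, hf.primitiveInvExt_robinEnergy_sub hγ hw]

theorem velocity_sq_lt_robinEnergy (hf : IsSource f) (hγ : 0 < γ) (hw : 0 < w) {t : ℝ}
    (ht : |t| ≤ halfTime f γ w) :
    velocity f (robinEnergy f γ w) t ^ 2 / 2 < robinEnergy f γ w := by
  have hV := pow_le_pow_left₀ (abs_nonneg _) (hf.abs_velocity_le ht) 2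
  rw [sq_abs] at hV
  linarith [sq_lt_robinEnergy hf.continuous hf.pos hγ hw]

theorem halfTime_hasDerivAt (hf : IsSource f) (hd : Differentiable ℝ f)
    (hf' : Continuous (deriv f)) (hγ : 0 < γ) (hw : 0 < w) :
    HasDerivAt (halfTime f γ)
      (positionVariation f (robinEnergy f γ w) (halfTime f γ w) -
        γ * velocityVariation f (robinEnergy f γ w) (halfTime f γ w)) w := by
  have hτ := hasDerivAt_comp₂_of_continuousAt_partials (g := travelTime f)
    (g₁ := travelTimeDeriv f) (g₂ := fun C v => slowness f (C - v ^ 2 / 2)) (x := w)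
    (a := robinEnergy f γ) (b := id) (b' := 1) ?_ ?_ ?_ ?_
    (robinEnergy_hasStrictDerivAt hf.continuous γ w).hasDerivAt (hasDerivAt_id w)
  · refine hτ.congr_deriv ?_
    simp only [positionVariation, velocityVariation, hf.velocity_halfTime,
      hf.position_halfTime hγ.le hw.le, slowness, id_eq,
      hf.primitiveInvExt_robinEnergy_sub hγ.le hw.le]
    ring
  · have hopen : IsOpen {p : ℝ × ℝ | p.2 ^ 2 / 2 < p.1} := isOpen_lt (by fun_prop) (by fun_prop)
    filter_upwards [hopen.mem_nhds (sq_lt_robinEnergy hf.continuous hf.pos hγ hw)] with p hp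
    exact hf.travelTime_hasDerivAt_energy hd hf' hp
  · exact .of_forall fun p => (hf.travelTime_hasStrictDerivAt p.1 p.2).hasDerivAt
  · exact (hf.travelTimeDeriv_continuous_uncurry hf').continuousAt
  · have := hf.slowness_continuous
    exact Continuous.continuousAt (by fun_prop)

end IsSource

end HalfTime

section CriticalPoints

variable {γ w w₀ : ℝ}

theorem IsTrajectory.mono {s t : Set ℝ} {v u : ℝ → ℝ} (h : IsTrajectory f t v u) (hst : s ⊆ t) :
    IsTrajectory f s v u :=
  ⟨fun x hx => h.position x (hst hx), fun x hx => h.velocity x (hst hx)⟩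

theorem IsLinearizedTrajectory.mono {s t : Set ℝ} {u r φ : ℝ → ℝ}
    (h : IsLinearizedTrajectory f t u r φ) (hst : s ⊆ t) : IsLinearizedTrajectory f s u r φ :=
  ⟨fun x hx => h.position x (hst hx), fun x hx => h.velocity x (hst hx)⟩

theorem wronskian_zero_eq_zero (hf : IsSource f) (C₀ C : ℝ) :
    wronskian (velocity f C₀) (position f C₀) (velocity f C) (position f C)
      (velocityVariation f C₀) (positionVariation f C₀) 0 = 0 := by
  simp [wronskian, velocityVariation, hf.velocity_zero, travelTimeDeriv_zero]

namespace IsSource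

theorem velocityVariation_nonneg (hf : IsSource f) (C : ℝ) {t : ℝ} (ht : 0 ≤ t) :
    0 ≤ velocityVariation f C t :=
  neg_nonneg.2 (mul_nonpos_of_nonneg_of_nonpos (hf.pos _).le
    (hf.travelTimeDeriv_nonpos C (hf.velocity_nonneg C ht)))

theorem positionVariation_antitoneOn (hf : IsSource f) (hd : Differentiable ℝ f)
    (hf' : Continuous (deriv f)) {C T : ℝ} (hT : ∀ t ∈ Icc 0 T, velocity f C t ^ 2 / 2 < C) :
    AntitoneOn (positionVariation f C) (Icc 0 T) := by
  have hφ := (hf.isLinearizedTrajectory hd hf' C).position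
  refine antitoneOn_of_hasDerivWithinAt_nonpos (convex_Icc 0 T)
    (f' := fun t => -velocityVariation f C t)
    (fun t ht => (hφ t (hT t ht)).continuousAt.continuousWithinAt)
    (fun t ht => (hφ t (hT t (interior_subset ht))).hasDerivWithinAt)
    fun t ht => neg_nonpos.2 (hf.velocityVariation_nonneg C (interior_subset ht).1)

theorem position_apex_ne (hf : IsSource f) {C₀ C : ℝ} (hC₀ : 0 ≤ C₀) (hC : 0 ≤ C) (hne : C₀ ≠ C) :
    position f C₀ 0 ≠ position f C 0 := fun h => by
  have := congrArg (primitive f) h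
  simp only [position, hf.velocity_zero, hf.primitive_primitiveInvExt] at this
  norm_num [hC₀, hC, hne] at this

theorem velocityVariation_pos_of_robin (hf : IsSource f) {C T : ℝ} (hT : 0 ≤ T)
    (hrobin : positionVariation f C T = γ * velocityVariation f C T) :
    0 < velocityVariation f C T := by
  refine (hf.velocityVariation_nonneg C hT).lt_of_ne' fun h => ?_
  have hfP := hf.pos (position f C T)
  have hτ : travelTimeDeriv f C (velocity f C T) = 0 := by
    simpa [velocityVariation, hfP.ne'] using h
  rw [h, mul_zero, positionVariation, hτ, mul_zero, add_zero] at hrobin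
  exact (inv_pos.2 hfP).ne' hrobin

theorem positionVariation_pos_of_robin (hf : IsSource f) (hd : Differentiable ℝ f)
    (hf' : Continuous (deriv f)) (hγ : 0 < γ) {C T : ℝ}
    (hT : ∀ t ∈ Icc 0 T, velocity f C t ^ 2 / 2 < C)
    (hrobin : positionVariation f C T = γ * velocityVariation f C T) {t : ℝ} (ht : t ∈ Icc 0 T) :
    0 < positionVariation f C t := by
  have hT₀ : 0 ≤ T := ht.1.trans ht.2
  calc 0 < γ * velocityVariation f C T :=
        mul_pos hγ (hf.velocityVariation_pos_of_robin hT₀ hrobin)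
    _ = positionVariation f C T := hrobin.symm
    _ ≤ positionVariation f C t :=
        hf.positionVariation_antitoneOn hd hf' hT ht (right_mem_Icc.2 hT₀) ht.2

theorem mul_velocity_le_position (hf : IsSource f) (hγ : 0 ≤ γ) (hw : 0 ≤ w) {t : ℝ} (ht : 0 ≤ t)
    (htT : t ≤ halfTime f γ w) :
    γ * velocity f (robinEnergy f γ w) t ≤ position f (robinEnergy f γ w) t := by
  have hV₀ := hf.velocity_nonneg (robinEnergy f γ w) ht
  have hV : velocity f (robinEnergy f γ w) t ≤ w :=
    (hf.velocity_monotone _ htT).trans_eq (hf.velocity_halfTime γ w)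
  calc γ * velocity f (robinEnergy f γ w) t ≤ γ * w := mul_le_mul_of_nonneg_left hV hγ
    _ = primitiveInvExt f (robinEnergy f γ w - w ^ 2 / 2) :=
      (hf.primitiveInvExt_robinEnergy_sub hγ hw).symm
    _ ≤ position f (robinEnergy f γ w) t :=
      hf.primitiveInvExt_monotone (by linarith [pow_le_pow_left₀ hV₀ hV 2])

theorem halfTime_lt_of_deriv_eq_zero (hf : IsSource f) (hd : Differentiable ℝ f)
    (hconv : StrictConvexOn ℝ univ f) (hγ : 0 < γ) (hw₀ : 0 < w₀)
    (hcrit : deriv (halfTime f γ) w₀ = 0) (hw : 0 < w) (hne : w₀ ≠ w) :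
    halfTime f γ w < halfTime f γ w₀ := by
  by_contra! hle
  have hf' := continuous_deriv_of_strictConvexOn hd hconv
  set C₀ := robinEnergy f γ w₀
  set C := robinEnergy f γ w
  set T := halfTime f γ w₀
  have hT : 0 < T := hf.halfTime_pos γ hw₀
  have hCne : C₀ ≠ C :=
    (robinEnergy_strictMonoOn hf.continuous hf.pos hγ.le).injOn.ne hw₀.le hw.le hne
  have habs : ∀ t ∈ Icc 0 T, |t| ≤ T := fun t ht => (abs_of_nonneg ht.1).trans_le ht.2
  have h₀dom : ∀ t ∈ Icc 0 T, velocity f C₀ t ^ 2 / 2 < C₀ := fun t ht =>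
    hf.velocity_sq_lt_robinEnergy hγ hw₀ (habs t ht)
  have hdom : ∀ t ∈ Icc 0 T, velocity f C t ^ 2 / 2 < C := fun t ht =>
    hf.velocity_sq_lt_robinEnergy hγ hw ((habs t ht).trans hle)
  have hrobin : positionVariation f C₀ T = γ * velocityVariation f C₀ T :=
    sub_eq_zero.1 ((hf.halfTime_hasDerivAt hd hf' hγ hw₀).deriv.symm.trans hcrit)
  have hr : 0 < velocityVariation f C₀ T := hf.velocityVariation_pos_of_robin hT.le hrobin
  have hapex : position f C₀ 0 ≠ position f C 0 := hf.position_apex_ne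
    (robinEnergy_nonneg hf.continuous hf.pos hγ.le hw₀.le)
    (robinEnergy_nonneg hf.continuous hf.pos hγ.le hw.le) hCne
  have hW := wronskian_lt_of_strictConvexOn hd hconv hT ((hf.isTrajectory C₀).mono h₀dom)
    ((hf.isTrajectory C).mono hdom) ((hf.isLinearizedTrajectory hd hf' C₀).mono h₀dom)
    (fun t ht => hf.positionVariation_pos_of_robin hd hf' hγ h₀dom hrobin ht) hapex
  have hWT : wronskian (velocity f C₀) (position f C₀) (velocity f C) (position f C)
      (velocityVariation f C₀) (positionVariation f C₀) T =
      velocityVariation f C₀ T * (position f C T - γ * velocity f C T) := by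
    rw [wronskian, hrobin, hf.velocity_halfTime, hf.position_halfTime hγ.le hw₀.le]
    ring
  rw [wronskian_zero_eq_zero hf, hWT] at hW
  exact hW.not_ge (mul_nonneg hr.le
    (sub_nonneg.2 (hf.mul_velocity_le_position hγ.le hw.le hT.le hle)))

theorem exists_deriv_halfTime_eq_zero (hf : IsSource f)
    (hsuper : Tendsto (fun u => f u / u) atTop atTop) (hγ : 0 < γ) :
    ∃ w, 0 < w ∧ deriv (halfTime f γ) w = 0 := by
  obtain ⟨b, hb, hb₁⟩ := (((hf.tendsto_halfTime_atTop hsuper hγ).eventually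
    (gt_mem_nhds (hf.halfTime_pos γ one_pos))).and (eventually_gt_atTop 1)).exists
  obtain ⟨a, ha, hab⟩ := intermediate_value_Icc zero_le_one (hf.halfTime_continuous γ).continuousOn
    ⟨(halfTime_zero γ).trans_le (hf.halfTime_nonneg γ (one_pos.trans hb₁).le), hb.le⟩
  obtain ⟨w, hw, hcrit⟩ := exists_deriv_eq_zero (ha.2.trans_lt hb₁)
    (hf.halfTime_continuous γ).continuousOn hab
  exact ⟨w, ha.1.trans_lt hw.1, hcrit⟩

theorem existsUnique_deriv_halfTime_eq_zero (hf : IsSource f) (hd : Differentiable ℝ f)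
    (hconv : StrictConvexOn ℝ univ f) (hsuper : Tendsto (fun u => f u / u) atTop atTop)
    (hγ : 0 < γ) : ∃! w, 0 < w ∧ deriv (halfTime f γ) w = 0 := by
  obtain ⟨w₀, hw₀, hcrit₀⟩ := hf.exists_deriv_halfTime_eq_zero hsuper hγ
  refine ⟨w₀, ⟨hw₀, hcrit₀⟩, fun w ⟨hw, hcrit⟩ => ?_⟩
  by_contra hne
  exact lt_asymm (hf.halfTime_lt_of_deriv_eq_zero hd hconv hγ hw hcrit hw₀ hne)
    (hf.halfTime_lt_of_deriv_eq_zero hd hconv hγ hw₀ hcrit₀ hw (Ne.symm hne))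

theorem exists_forall_halfTime_le (hf : IsSource f)
    (hsuper : Tendsto (fun u => f u / u) atTop atTop) (hγ : 0 < γ) :
    ∃ M, ∀ w, 0 ≤ w → halfTime f γ w ≤ M := by
  obtain ⟨N, hN⟩ := eventually_atTop.1
    ((hf.tendsto_halfTime_atTop hsuper hγ).eventually (eventually_le_nhds one_pos))
  obtain ⟨M, hM⟩ := (isCompact_Icc (a := 0) (b := N)).bddAbove_image
    (hf.halfTime_continuous γ).continuousOn
  refine ⟨max M 1, fun w hw => ?_⟩
  rcases le_total w N with h | h
  · exact (hM (mem_image_of_mem _ ⟨hw, h⟩)).trans (le_max_left _ _)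
  · exact (hN w h).trans (le_max_right _ _)

end IsSource

end CriticalPoints

section Length

variable {lam α : ℝ}

theorem neg_mem_phaseCurve {C v u : ℝ} : (-v, u) ∈ phaseCurve f C ↔ (v, u) ∈ phaseCurve f C := by
  simp only [phaseCurve, mem_ofPred_eq, neg_sq]

theorem sqrt_div_pos (hlam : 0 < lam) (hα : 0 < α) : 0 < √lam / α :=
  div_pos (Real.sqrt_pos.2 hlam) hα

namespace IsSource

theorem vOne_nonneg (hf : IsSource f) (hlam : 0 < lam) (hα : 0 < α) {C : ℝ} (hC : 0 ≤ C) :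
    0 ≤ vOne f lam α C :=
  (Classical.epsilon_spec
    (existsUnique_vOne hf.continuous hf.monotone hf.pos hlam hα hC).exists).1

theorem robinEnergy_of_mem_phaseCurve (hf : IsSource f) {C v γ : ℝ}
    (h : (v, γ * v) ∈ phaseCurve f C) : robinEnergy f γ v = C := by
  have := (primitiveInv_eq_iff hf.continuous hf.monotone hf.pos (sub_nonneg.2 h.1)).1 h.2
  exact add_eq_of_eq_sub this

theorem robinEnergy_vOne (hf : IsSource f) (hlam : 0 < lam) (hα : 0 < α) {C : ℝ} (hC : 0 ≤ C) :
    robinEnergy f (√lam / α) (vOne f lam α C) = C :=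
  hf.robinEnergy_of_mem_phaseCurve (Classical.epsilon_spec
    (existsUnique_vOne hf.continuous hf.monotone hf.pos hlam hα hC).exists).2.1

theorem vOne_robinEnergy (hf : IsSource f) (hlam : 0 < lam) (hα : 0 < α) {w : ℝ} (hw : 0 ≤ w) :
    vOne f lam α (robinEnergy f (√lam / α) w) = w := by
  have hγ := (sqrt_div_pos hlam hα).le
  have hE := robinEnergy_nonneg hf.continuous hf.pos hγ hw
  exact (robinEnergy_strictMonoOn hf.continuous hf.pos hγ).injOn (hf.vOne_nonneg hlam hα hE) hw
    (hf.robinEnergy_vOne hlam hα hE)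

theorem vOne_pos (hf : IsSource f) (hlam : 0 < lam) (hα : 0 < α) {C : ℝ} (hC : 0 < C) :
    0 < vOne f lam α C := by
  refine (hf.vOne_nonneg hlam hα hC.le).lt_of_ne' fun h => hC.ne' ?_
  rw [← hf.robinEnergy_vOne hlam hα hC.le, h, robinEnergy_zero]

theorem vOne_sq_le (hf : IsSource f) (hlam : 0 < lam) (hα : 0 < α) {C : ℝ} (hC : 0 ≤ C) :
    vOne f lam α C ^ 2 / 2 ≤ C :=
  (Classical.epsilon_spec
    (existsUnique_vOne hf.continuous hf.monotone hf.pos hlam hα hC).exists).2.1.1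

theorem vOne_hasDerivAt (hf : IsSource f) (hlam : 0 < lam) (hα : 0 < α) {C : ℝ} (hC : 0 < C) :
    HasDerivAt (vOne f lam α)
      (√lam / α * f (√lam / α * vOne f lam α C) + vOne f lam α C)⁻¹ C := by
  have hγ := sqrt_div_pos hlam hα
  have hw := hf.vOne_pos hlam hα hC
  have h := (robinEnergy_hasStrictDerivAt hf.continuous (√lam / α)
    (vOne f lam α C)).to_local_left_inverse (g := vOne f lam α)
    (add_pos (mul_pos hγ (hf.pos _)) hw).ne' ?_
  · rw [hf.robinEnergy_vOne hlam hα hC.le] at h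
    exact h.hasDerivAt
  · filter_upwards [lt_mem_nhds hw] with y hy
    exact hf.vOne_robinEnergy hlam hα hy.le

theorem tendsto_vOne_zero (hf : IsSource f) (hlam : 0 < lam) (hα : 0 < α) :
    Tendsto (vOne f lam α) (𝓝[>] 0) (𝓝 0) := by
  have hsqrt : Tendsto (fun C : ℝ => √(2 * C)) (𝓝[>] 0) (𝓝 0) := by
    have : Continuous fun C : ℝ => √(2 * C) := by fun_prop
    simpa using (this.tendsto 0).mono_left nhdsWithin_le_nhds
  refine squeeze_zero' ?_ ?_ hsqrt
  · filter_upwards [self_mem_nhdsWithin] with C hC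
    exact hf.vOne_nonneg hlam hα (le_of_lt hC)
  · filter_upwards [self_mem_nhdsWithin] with C hC
    refine Real.le_sqrt_of_sq_le ?_
    linarith [hf.vOne_sq_le hlam hα (le_of_lt hC)]

theorem tendsto_vOne_atTop (hf : IsSource f) (hlam : 0 < lam) (hα : 0 < α) :
    Tendsto (vOne f lam α) atTop atTop := by
  have hE := robinEnergy_strictMonoOn hf.continuous hf.pos (sqrt_div_pos hlam hα).le
  refine tendsto_atTop.2 fun N => ?_
  filter_upwards [eventually_ge_atTop (robinEnergy f (√lam / α) (max N 0)), eventually_ge_atTop 0]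
    with C hC hC0
  rw [← hf.robinEnergy_vOne hlam hα hC0,
    hE.le_iff_le (mem_Ici.2 (le_max_right N 0)) (hf.vOne_nonneg hlam hα hC0)] at hC
  exact (le_max_left _ _).trans hC

theorem length_eq_halfTime (hf : IsSource f) (hlam : 0 < lam) (hα : 0 < α) {C : ℝ} (hC : 0 ≤ C) :
    length f lam α C = 2 / √lam * halfTime f (√lam / α) (vOne f lam α C) := by
  have hintegrand : ∀ v ∈ uIcc 0 (vOne f lam α C),
      1 / (√lam * f (primitiveInv f (C - v ^ 2 / 2))) =
        (√lam)⁻¹ * slowness f (C - v ^ 2 / 2) := fun v hv => by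
    rw [uIcc_of_le (hf.vOne_nonneg hlam hα hC)] at hv
    have hle : v ^ 2 / 2 ≤ C := by
      linarith [hf.vOne_sq_le hlam hα hC, pow_le_pow_left₀ hv.1 hv.2 2]
    rw [slowness, primitiveInvExt_of_nonneg (sub_nonneg.2 hle), one_div, mul_inv]
  rw [length, intervalIntegral.integral_congr hintegrand, intervalIntegral.integral_const_mul,
    halfTime, hf.robinEnergy_vOne hlam hα hC, travelTime]
  ring

theorem length_zero (hf : IsSource f) (hlam : 0 < lam) (hα : 0 < α) : length f lam α 0 = 0 := by
  have hv : vOne f lam α 0 = 0 := by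
    simpa only [robinEnergy_zero] using hf.vOne_robinEnergy hlam hα le_rfl
  rw [hf.length_eq_halfTime hlam hα le_rfl, hv, halfTime_zero, mul_zero]

theorem tendsto_length_zero (hf : IsSource f) (hlam : 0 < lam) (hα : 0 < α) :
    Tendsto (length f lam α) (𝓝[>] 0) (𝓝 0) := by
  have h := (((hf.halfTime_continuous (√lam / α)).tendsto 0).comp
    (hf.tendsto_vOne_zero hlam hα)).const_mul (2 / √lam)
  rw [halfTime_zero, mul_zero] at h
  refine h.congr' ?_
  filter_upwards [self_mem_nhdsWithin] with C hC
  exact (hf.length_eq_halfTime hlam hα (le_of_lt hC)).symm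

theorem tendsto_length_atTop (hf : IsSource f) (hsuper : Tendsto (fun u => f u / u) atTop atTop)
    (hlam : 0 < lam) (hα : 0 < α) : Tendsto (length f lam α) atTop (𝓝 0) := by
  have h := ((hf.tendsto_halfTime_atTop hsuper (sqrt_div_pos hlam hα)).comp
    (hf.tendsto_vOne_atTop hlam hα)).const_mul (2 / √lam)
  rw [mul_zero] at h
  refine h.congr' ?_
  filter_upwards [eventually_ge_atTop 0] with C hC
  exact (hf.length_eq_halfTime hlam hα hC).symm

theorem exists_abs_length_le (hf : IsSource f) (hsuper : Tendsto (fun u => f u / u) atTop atTop)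
    (hlam : 0 < lam) (hα : 0 < α) : ∃ M, ∀ C, 0 ≤ C → |length f lam α C| ≤ M := by
  obtain ⟨M, hM⟩ := hf.exists_forall_halfTime_le hsuper (sqrt_div_pos hlam hα)
  refine ⟨2 / √lam * M, fun C hC => ?_⟩
  have hv := hf.vOne_nonneg hlam hα hC
  have hcoef : 0 ≤ 2 / √lam := by positivity
  rw [hf.length_eq_halfTime hlam hα hC,
    abs_of_nonneg (mul_nonneg hcoef (hf.halfTime_nonneg _ hv))]
  exact mul_le_mul_of_nonneg_left (hM _ hv) hcoef

theorem length_hasDerivAt (hf : IsSource f) (hd : Differentiable ℝ f) (hf' : Continuous (deriv f))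
    (hlam : 0 < lam) (hα : 0 < α) {C : ℝ} (hC : 0 < C) :
    HasDerivAt (length f lam α)
      (2 / √lam * (deriv (halfTime f (√lam / α)) (vOne f lam α C) *
        (√lam / α * f (√lam / α * vOne f lam α C) + vOne f lam α C)⁻¹)) C := by
  have hT := (hf.halfTime_hasDerivAt hd hf' (sqrt_div_pos hlam hα)
    (hf.vOne_pos hlam hα hC)).differentiableAt.hasDerivAt
  refine ((hT.comp C (hf.vOne_hasDerivAt hlam hα hC)).const_mul (2 / √lam)).congr_of_eventuallyEq
    ?_
  filter_upwards [lt_mem_nhds hC] with c hc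
  exact hf.length_eq_halfTime hlam hα hc.le

theorem deriv_length_eq_zero_iff (hf : IsSource f) (hd : Differentiable ℝ f)
    (hf' : Continuous (deriv f)) (hlam : 0 < lam) (hα : 0 < α) {C : ℝ} (hC : 0 < C) :
    deriv (length f lam α) C = 0 ↔ deriv (halfTime f (√lam / α)) (vOne f lam α C) = 0 := by
  have hE' := (add_pos (mul_pos (sqrt_div_pos hlam hα) (hf.pos (√lam / α * vOne f lam α C)))
    (hf.vOne_pos hlam hα hC)).ne'
  rw [(hf.length_hasDerivAt hd hf' hlam hα hC).deriv, mul_eq_zero_iff_left (by positivity),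
    mul_eq_zero_iff_right (inv_ne_zero hE')]

theorem existsUnique_deriv_length_eq_zero (hf : IsSource f) (hd : Differentiable ℝ f)
    (hconv : StrictConvexOn ℝ univ f) (hsuper : Tendsto (fun u => f u / u) atTop atTop)
    (hlam : 0 < lam) (hα : 0 < α) : ∃! C, 0 < C ∧ deriv (length f lam α) C = 0 := by
  have hγ := sqrt_div_pos hlam hα
  have hiff := fun {C : ℝ} (hC : 0 < C) => hf.deriv_length_eq_zero_iff hd
    (continuous_deriv_of_strictConvexOn hd hconv) hlam hα hC
  obtain ⟨w, ⟨hw, hcrit⟩, huniq⟩ := hf.existsUnique_deriv_halfTime_eq_zero hd hconv hsuper hγ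
  have hE : 0 < robinEnergy f (√lam / α) w :=
    lt_of_le_of_lt (by positivity) (sq_lt_robinEnergy hf.continuous hf.pos hγ hw)
  refine ⟨robinEnergy f (√lam / α) w, ⟨hE, ?_⟩, fun C ⟨hC, hC'⟩ => ?_⟩
  · rwa [hiff hE, hf.vOne_robinEnergy hlam hα hw.le]
  · rw [← huniq (vOne f lam α C) ⟨hf.vOne_pos hlam hα hC, (hiff hC).1 hC'⟩,
      hf.robinEnergy_vOne hlam hα hC.le]

end IsSource

end Length

section Solutions

variable {lam α : ℝ}

theorem IsTrajectory.isRobinSolution (hlam : 0 < lam) {T : ℝ} {v u : ℝ → ℝ}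
    (h : IsTrajectory f (Icc (-T) T) v u) (hleft : √lam * v (-T) = -(α * u (-T)))
    (hright : √lam * v T = α * u T) :
    IsRobinSolution f lam α (2 / √lam * T) (fun x => u (√lam * x - T))
      (fun x => -(√lam * v (√lam * x - T))) := by
  have hs : 0 < √lam := Real.sqrt_pos.2 hlam
  have hend : √lam * (2 / √lam * T) - T = T := by
    field_simp
    ring
  have hmaps : ∀ x ∈ Icc 0 (2 / √lam * T), √lam * x - T ∈ Icc (-T) T := fun x hx => by
    have := mul_le_mul_of_nonneg_left hx.2 hs.le
    have := mul_nonneg hs.le hx.1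
    constructor <;> linarith
  have haff : ∀ x, HasDerivAt (fun x => √lam * x - T) √lam x := fun x => by
    simpa using ((hasDerivAt_id x).const_mul √lam).sub_const T
  have hvel : ∀ x ∈ Icc 0 (2 / √lam * T), HasDerivAt (fun x => -(√lam * v (√lam * x - T)))
      (-(lam * f (u (√lam * x - T)))) x := fun x hx => by
    refine (((h.velocity _ (hmaps x hx)).comp x (haff x)).const_mul √lam).neg.congr_deriv ?_
    rw [mul_left_comm, Real.mul_self_sqrt hlam.le, mul_comm]
  refine ⟨fun x hx => ?_, fun x hx => (hvel x hx).continuousAt.continuousWithinAt,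
    fun x hx => hvel x (Ioo_subset_Icc_self hx), ?_, ?_⟩
  · refine ((h.position _ (hmaps x hx)).comp x (haff x)).hasDerivWithinAt.congr_deriv ?_
    ring
  · simp only [mul_zero, zero_sub, hleft, neg_neg]
  · simp only [hend, hright]

theorem velocity_position_mem_phaseCurve {C t : ℝ} (h : velocity f C t ^ 2 / 2 ≤ C) :
    (velocity f C t, position f C t) ∈ phaseCurve f C :=
  ⟨h, primitiveInvExt_of_nonneg (sub_nonneg.2 h)⟩

theorem IsSource.exists_isRobinSolution (hf : IsSource f) (hlam : 0 < lam) (hα : 0 < α) {C : ℝ}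
    (hC : 0 < C) : ∃ u u' : ℝ → ℝ, IsRobinSolution f lam α (length f lam α C) u u' ∧
      ∀ x ∈ Icc 0 (length f lam α C), (u' x / √lam, u x) ∈ phaseCurve f C := by
  have hs : 0 < √lam := Real.sqrt_pos.2 hlam
  have hγ := sqrt_div_pos hlam hα
  have hw := hf.vOne_pos hlam hα hC
  have hE := hf.robinEnergy_vOne hlam hα hC.le
  rw [hf.length_eq_halfTime hlam hα hC.le]
  set w := vOne f lam α C
  set T := halfTime f (√lam / α) w
  have hV : velocity f C T = w := hE ▸ hf.velocity_halfTime (√lam / α) w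
  have hP : position f C T = √lam / α * w := hE ▸ hf.position_halfTime hγ.le hw.le
  have hdom : ∀ t ∈ Icc (-T) T, velocity f C t ^ 2 / 2 < C := fun t ht => by
    simpa only [hE] using hf.velocity_sq_lt_robinEnergy hγ hw (abs_le.2 ht)
  have hright : √lam * velocity f C T = α * position f C T := by
    rw [hV, hP]
    field_simp
  refine ⟨_, _, ((hf.isTrajectory C).mono hdom).isRobinSolution hlam ?_ hright, fun x hx => ?_⟩
  · rw [hf.velocity_neg, hf.position_neg, mul_neg, hright]
  · have hmem : √lam * x - T ∈ Icc (-T) T := by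
      have hx₂ : √lam * x ≤ 2 * T := by
        simpa only [← mul_assoc, mul_div_cancel₀ _ hs.ne'] using
          mul_le_mul_of_nonneg_left hx.2 hs.le
      constructor <;> linarith [mul_nonneg hs.le hx.1]
    rw [neg_div, mul_div_cancel_left₀ _ hs.ne', neg_mem_phaseCurve]
    exact velocity_position_mem_phaseCurve (hdom _ hmem).le

theorem IsSource.eq_vOne_of_mem_phaseCurve (hf : IsSource f) (hlam : 0 < lam) (hα : 0 < α)
    {C v u : ℝ} (hu : (v, u) ∈ phaseCurve f C) (hrobin : √lam * v = α * u) :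
    v = vOne f lam α C := by
  have hs : 0 < √lam := Real.sqrt_pos.2 hlam
  have hu0 : 0 ≤ u := by
    obtain ⟨hle, rfl⟩ : v ^ 2 / 2 ≤ C ∧ u = primitiveInv f (C - v ^ 2 / 2) := hu
    rw [← primitiveInvExt_of_nonneg (sub_nonneg.2 hle)]
    exact hf.primitiveInvExt_nonneg _
  have hv0 : 0 ≤ v := nonneg_of_mul_nonneg_right (hrobin ▸ mul_nonneg hα.le hu0) hs
  obtain rfl : u = √lam / α * v := by
    field_simp
    rw [mul_comm, hrobin]
  rw [← hf.robinEnergy_of_mem_phaseCurve hu, hf.vOne_robinEnergy hlam hα hv0]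

theorem IsRobinSolution.travelTime_sub_eq (hf : IsSource f) (hlam : 0 < lam) {C ℓ : ℝ}
    (hℓ : 0 < ℓ) {u u' : ℝ → ℝ} (h : IsRobinSolution f lam α ℓ u u')
    (hK : ∀ x ∈ Icc 0 ℓ, (u' x / √lam, u x) ∈ phaseCurve f C) :
    travelTime f C (u' ℓ / √lam) - travelTime f C (u' 0 / √lam) = -√lam * ℓ := by
  have hτ := fun v => (hf.travelTime_hasStrictDerivAt C v).hasDerivAt
  have hτcont : Continuous (travelTime f C) :=
    continuous_iff_continuousAt.2 fun v => (hτ v).continuousAt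
  have hderiv : ∀ x ∈ Ioo 0 ℓ,
      HasDerivAt (fun x => travelTime f C (u' x / √lam)) (-√lam) x := fun x hx => by
    refine ((hτ (u' x / √lam)).comp x ((h.equation x hx).div_const √lam)).congr_deriv ?_
    obtain ⟨hle, heq⟩ := hK x (Ioo_subset_Icc_self hx)
    rw [slowness, primitiveInvExt_of_nonneg (sub_nonneg.2 hle), ← heq]
    have hne := (hf.pos (u x)).ne'
    field_simp
    rw [Real.sq_sqrt hlam.le]
  obtain ⟨x, -, hslope⟩ := exists_hasDerivAt_eq_slope _ (fun _ => -√lam) hℓ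
    (hτcont.comp_continuousOn (h.continuousOn.div_const √lam)) hderiv
  rw [sub_zero, eq_div_iff hℓ.ne'] at hslope
  exact hslope.symm

theorem IsRobinSolution.eq_length (hf : IsSource f) (hlam : 0 < lam) (hα : 0 < α) {C ℓ : ℝ}
    (hC : 0 ≤ C) (hℓ : 0 < ℓ) {u u' : ℝ → ℝ} (h : IsRobinSolution f lam α ℓ u u')
    (hK : ∀ x ∈ Icc 0 ℓ, (u' x / √lam, u x) ∈ phaseCurve f C) : ℓ = length f lam α C := by
  have hs : 0 < √lam := Real.sqrt_pos.2 hlam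
  have hleft : u' 0 / √lam = vOne f lam α C :=
    hf.eq_vOne_of_mem_phaseCurve hlam hα (hK 0 (left_mem_Icc.2 hℓ.le)) (by
      rw [mul_div_cancel₀ _ hs.ne', h.left])
  have hright : -(u' ℓ / √lam) = vOne f lam α C :=
    hf.eq_vOne_of_mem_phaseCurve hlam hα
      (neg_mem_phaseCurve.2 (hK ℓ (right_mem_Icc.2 hℓ.le))) (by
        rw [mul_neg, mul_div_cancel₀ _ hs.ne', h.right, neg_neg])
  have hτ := h.travelTime_sub_eq hf hlam hℓ hK
  rw [hleft, neg_eq_iff_eq_neg.1 hright, travelTime_neg] at hτ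
  rw [hf.length_eq_halfTime hlam hα hC, halfTime, hf.robinEnergy_vOne hlam hα hC]
  field_simp
  linarith

end Solutions

end RobinTimeMap

end

open RobinTimeMap in
theorem mainTheorem1_general (f : ℝ → ℝ) (hf : Differentiable ℝ f) (hpos : ∀ u, 0 < f u)
    (hmono : Monotone f) (hsuper : Tendsto (fun u => f u / u) atTop atTop)
    (hconv : StrictConvexOn ℝ univ f) (lam α : ℝ) (hlam : 0 < lam) (hα : 0 < α) :
    (∀ C, 0 < C → ∀ ℓ, 0 < ℓ →
      ((∃ u u' : ℝ → ℝ, IsRobinSolution f lam α ℓ u u' ∧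
          ∀ x ∈ Icc 0 ℓ, (u' x / √lam, u x) ∈ phaseCurve f C) ↔
        ℓ = RobinTimeMap.length f lam α C)) ∧
    (∃ M : ℝ, ∀ C, 0 ≤ C → |RobinTimeMap.length f lam α C| ≤ M) ∧
    RobinTimeMap.length f lam α 0 = 0 ∧
    Tendsto (RobinTimeMap.length f lam α) (𝓝[>] 0) (𝓝 0) ∧
    Tendsto (RobinTimeMap.length f lam α) atTop (𝓝 0) ∧
    DifferentiableOn ℝ (RobinTimeMap.length f lam α) (Ioi 0) ∧
    ∃! C : ℝ, 0 < C ∧ deriv (RobinTimeMap.length f lam α) C = 0 := by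
  have hsrc : IsSource f := ⟨hf.continuous, hmono, hpos⟩
  have hf' := continuous_deriv_of_strictConvexOn hf hconv
  refine ⟨fun C hC ℓ hℓ => ⟨?_, ?_⟩, hsrc.exists_abs_length_le hsuper hlam hα,
    hsrc.length_zero hlam hα, hsrc.tendsto_length_zero hlam hα,
    hsrc.tendsto_length_atTop hsuper hlam hα, fun C hC => ?_,
    hsrc.existsUnique_deriv_length_eq_zero hf hconv hsuper hlam hα⟩
  · rintro ⟨u, u', hu, hK⟩
    exact hu.eq_length hsrc hlam hα hC.le hℓ hK
  · rintro rfl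
    exact hsrc.exists_isRobinSolution hlam hα hC
  · exact (hsrc.length_hasDerivAt hf hf' hlam hα hC).differentiableAt.differentiableWithinAt

theorem mainTheorem1 (f : ℝ → ℝ) (hf : Differentiable ℝ f) (hf' : Differentiable ℝ (deriv f))
    (hpos : ∀ u, 0 < f u) (hmono : ∀ u, 0 ≤ deriv f u)
    (hsuper : Tendsto (fun u => f u / u) atTop atTop)
    (hconv : ∀ u, 0 < deriv (deriv f) u)
    (lam α : ℝ) (hlam : 0 < lam) (hα : 0 < α) :
    -- `L(C)` is the length of the interval of the Robin solutions whose trajectory lies on `K_C`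
    (∀ C, 0 < C → ∀ ℓ, 0 < ℓ →
      ((∃ u u' : ℝ → ℝ, RobinTimeMap.IsRobinSolution f lam α ℓ u u' ∧
          ∀ x ∈ Icc 0 ℓ, (u' x / Real.sqrt lam, u x) ∈ RobinTimeMap.phaseCurve f C) ↔
        ℓ = RobinTimeMap.length f lam α C)) ∧
    (∃ M : ℝ, ∀ C, 0 ≤ C → |RobinTimeMap.length f lam α C| ≤ M) ∧
    RobinTimeMap.length f lam α 0 = 0 ∧
    Tendsto (RobinTimeMap.length f lam α) (𝓝[>] 0) (𝓝 0) ∧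
    Tendsto (RobinTimeMap.length f lam α) atTop (𝓝 0) ∧
    DifferentiableOn ℝ (RobinTimeMap.length f lam α) (Ioi 0) ∧
    ∃! C : ℝ, 0 < C ∧ deriv (RobinTimeMap.length f lam α) C = 0 :=
  mainTheorem1_general f hf hpos (monotone_of_deriv_nonneg hf hmono) hsuper
    ((strictMono_of_deriv_pos hconv).strictConvexOn_univ_of_deriv hf.continuous) lam α hlam hα
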